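/- Let $n\ge 5$ and let $(m_{ij})_{1\le i,j\le n}$ be a symmetric matrix with $m_{ii}=1$ and $m_{ij}\in\{2,3,4,\dots\}\cup\{\infty\}$ for $i\ne j$, and let $$W=\langle s_1,\dots,s_n \mid (s_is_j)^{m_{ij}}=1 \text{ whenever } m_{ij}\neq\infty\rangle$$ be the associated Coxeter group of rank $n$. Assume that - $m_{12}$ and $m_{n-1,n}$ are finite, and the least divisor greater than $1$ of each of them is at least $5$; - for $2\le i\le n-2$, $m_{i,i+1}$ is finite with least divisor greater than $1$ equal to $3$ (i.e. $m_{i,i+1}$ is an odd multiple of $3$); - each of $m_{13}$ and $m_{n-2,n}$ is either $\infty$ or an odd multiple of $3$; - $m_{ij}=\infty$ for all other pairs $i<j$. A reflection of $W$ is a conjugate of some $s_i$. Then $W$ has no finite-index reflection subgroup; that is, there is no subgroup $V\subsetneq W$ of finite index which is generated by reflections of $W$. -/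

import Mathlib

/-- The underlying graph of the divisibility diagram of a Coxeter system with Coxeter matrix `M`:
the vertices are the generators, and two distinct generators are joined iff `m i j` is finite.
(In `CoxeterMatrix`, the exponent `∞` is represented by `0`.) -/
def CoxeterMatrix.divGraph {B : Type*} (M : CoxeterMatrix B) : SimpleGraph B where
  Adj i j := i ≠ j ∧ M i j ≠ 0
  symm := ⟨fun i j h => ⟨h.1.symm, by rw [M.symmetric j i]; exact h.2⟩⟩
  loopless := ⟨fun _ h => h.1 rfl⟩

/-- The label of an edge `{i, j}` of the divisibility diagram: the least divisor greater than `1`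
of `m i j`. It is only used for pairs `i, j` adjacent in `M.divGraph`, for which `2 ≤ m i j < ∞`. -/
def CoxeterMatrix.divLabel {B : Type*} (M : CoxeterMatrix B) (i j : B) : ℕ :=
  (M i j).minFac

/-- The divisibility diagram of `M` is a path with `n` vertices (numbered `0, …, n - 1` from left
to right), possibly with one extra edge closing up each of its two ends to a triangle.
The first and the last edge of the path carry labels at least `5`, all other edges of the path
carry label `3`, and each of the two additional pairs `{0, 2}`, `{n - 3, n - 1}` is either not
joined or joined by an edge with label `3`. There are no further edges. -/
structure CoxeterMatrix.IsPathSeries {n : ℕ} (M : CoxeterMatrix (Fin n)) : Prop where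
  first_edge : ∀ i j : Fin n, (i : ℕ) = 0 → (j : ℕ) = 1 →
    M.divGraph.Adj i j ∧ 5 ≤ M.divLabel i j
  last_edge : ∀ i j : Fin n, (i : ℕ) + 2 = n → (j : ℕ) + 1 = n →
    M.divGraph.Adj i j ∧ 5 ≤ M.divLabel i j
  inner_edge : ∀ i j : Fin n, 1 ≤ (i : ℕ) → (j : ℕ) = (i : ℕ) + 1 → (j : ℕ) + 2 ≤ n →
    M.divGraph.Adj i j ∧ M.divLabel i j = 3
  left_chord : ∀ i j : Fin n, (i : ℕ) = 0 → (j : ℕ) = 2 →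
    M.divGraph.Adj i j → M.divLabel i j = 3
  right_chord : ∀ i j : Fin n, (i : ℕ) + 3 = n → (j : ℕ) + 1 = n →
    M.divGraph.Adj i j → M.divLabel i j = 3
  no_other_edge : ∀ i j : Fin n, (i : ℕ) + 1 < (j : ℕ) →
    ¬ ((i : ℕ) = 0 ∧ (j : ℕ) = 2) → ¬ ((i : ℕ) + 3 = n ∧ (j : ℕ) + 1 = n) →
    ¬ M.divGraph.Adj i j

/-- A reflection subgroup of a Coxeter group: a proper subgroup generated by reflections, that is,
by conjugates of the simple generators. -/
def CoxeterSystem.IsReflectionSubgroup {B : Type*} {M : CoxeterMatrix B} {W : Type*} [Group W]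
    (cs : CoxeterSystem M W) (V : Subgroup W) : Prop :=
  V ≠ ⊤ ∧ ∃ T : Set W, (∀ t ∈ T, cs.IsReflection t) ∧ Subgroup.closure T = V

/-! Let `V` be generated by reflections and put `X = W ⧸ V`. A cocycle on `X` vanishing wherever a
generator fixes a point restricts to a homomorphism on `V` that kills the generating reflections, so
it is a coboundary (`hasPotentials_quotient`).

Split `W` as an amalgam over `⟨s_h⟩`, where `h` is the third generator. Coboundaries make every
function on the two-point `s_h`-orbits a sum of functions on the orbits of the two factors. The
bipartite graph with these orbits as edges and vertices is finite, so it has a leaf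
(`exists_movesOnePair`): an orbit `O` of one factor where `s_h` moves a single pair.

Odd exponents make neighbouring generators conjugate, so each generator on that side moves a single
pair of `O`. At the end edge, whose exponent is prime to 6, the two pairs must coincide. A cocycle
twisting this double edge is then not a coboundary (`not_movesOnePair`). -/

namespace CoxeterSystem

/-! ### Cocycles on a `W`-set -/

variable {B : Type*} {M : CoxeterMatrix B} {W : Type*} [Group W] (cs : CoxeterSystem M W)
  {X : Type*} [MulAction W X]

/-- The lift of the action of a simple generator on `X` to `X × G`, twisted by `c`. -/
def shear {G : Type*} [AddCommGroup G] (c : B → X → G) (j : B) : Function.End (X × G) :=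
  fun y => (cs.simple j • y.1, y.2 + c j y.1)

theorem shear_mul_apply {G : Type*} [AddCommGroup G] (c : B → X → G) (i j : B) (x : X) (a : G) :
    (cs.shear c i * cs.shear c j) (x, a) =
      (cs.simple i • cs.simple j • x, a + c j x + c i (cs.simple j • x)) := rfl

/-- Every cocycle on `X` that vanishes at the fixed points of the simple generators is
a coboundary. -/
def HasPotentials (X : Type*) [MulAction W X] : Prop :=
  ∀ (G : Type) [AddCommGroup G] (c : B → X → G),
    (∀ j x, cs.simple j • x = x → c j x = 0) → M.IsLiftable (cs.shear c) →
    ∃ g : X → G, ∀ j x, g (cs.simple j • x) = g x + c j x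

/-- The shears define an action of `W` on `(W ⧸ V) × G`. If `w s w⁻¹ ∈ T`, then `s` fixes the coset
of `w⁻¹`, where `c` vanishes, so `w s w⁻¹` fixes the point `(V, 0)`. Hence all of `V` fixes it, and
its orbit is the graph of a potential. -/
theorem hasPotentials_quotient {V : Subgroup W} {T : Set W}
    (hT : ∀ t ∈ T, cs.IsReflection t) (hTV : Subgroup.closure T = V) :
    cs.HasPotentials (W ⧸ V) := by
  intro G _ c hc hrel
  let φ : W →* Function.End ((W ⧸ V) × G) := cs.lift ⟨_, hrel⟩
  have hφs : ∀ j y, φ (cs.simple j) y = (cs.simple j • y.1, y.2 + c j y.1) := fun j y => by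
    change cs.lift ⟨_, hrel⟩ (cs.simple j) y = _
    rw [cs.lift_apply_simple hrel]
    rfl
  have hmul : ∀ w w' y, φ (w * w') y = φ w (φ w' y) := fun w w' y => by rw [map_mul]; rfl
  have hone : ∀ y, φ 1 y = y := fun y => by rw [map_one]; rfl
  have hfst : ∀ w y, (φ w y).1 = w • y.1 := fun w => by
    induction w using cs.simple_induction_left with
    | one => intro y; rw [hone, one_smul]
    | mul_simple_left w i ih => intro y; rw [hmul, hφs, ih, mul_smul]
  let x₀ : (W ⧸ V) × G := ((1 : W), 0)
  let S : Subgroup W :=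
    { carrier := {w | φ w x₀ = x₀}
      one_mem' := hone x₀
      mul_mem' := fun {a b} ha hb => by
        change φ (a * b) x₀ = x₀
        rw [hmul, show φ b x₀ = x₀ from hb, show φ a x₀ = x₀ from ha]
      inv_mem' := fun {a} ha => by
        change φ a⁻¹ x₀ = x₀
        conv_lhs => rw [← show φ a x₀ = x₀ from ha]
        rw [← hmul, inv_mul_cancel, hone] }
  have hVS : V ≤ S := by
    rw [← hTV]
    refine (Subgroup.closure_le S).2 fun t ht => ?_
    obtain ⟨w, i, rfl⟩ := hT t ht
    change φ (w * cs.simple i * w⁻¹) x₀ = x₀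
    have hfix : cs.simple i • (φ w⁻¹ x₀).1 = (φ w⁻¹ x₀).1 := by
      rw [hfst]
      have h1 : (w * cs.simple i * w⁻¹) • x₀.1 = x₀.1 := by
        change (((w * cs.simple i * w⁻¹) * 1 : W) : W ⧸ V) = ((1 : W) : W ⧸ V)
        rw [mul_one]
        refine (QuotientGroup.eq.2 ?_).symm
        rw [inv_one, one_mul, ← hTV]
        exact Subgroup.subset_closure ht
      rw [mul_smul, mul_smul] at h1
      rw [eq_inv_smul_iff]
      exact h1
    rw [hmul, hmul, hφs, hfix, hc _ _ hfix, add_zero, ← hmul, mul_inv_cancel, hone]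
  have hwd : ∀ a b : W, (a : W ⧸ V) = b → φ a x₀ = φ b x₀ := fun a b hab => by
    have h1 : φ (a⁻¹ * b) x₀ = x₀ := hVS (QuotientGroup.eq.1 hab)
    conv_lhs => rw [← h1]
    rw [← hmul, mul_inv_cancel_left]
  refine ⟨fun x => (φ x.out x₀).2, fun j x => ?_⟩
  have h1 : φ (cs.simple j • x).out x₀ = φ (cs.simple j * x.out) x₀ := by
    apply hwd
    rw [QuotientGroup.out_eq']
    conv_lhs => rw [← QuotientGroup.out_eq' x]
    rfl
  have h2 : (φ x.out x₀).1 = x := by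
    rw [hfst]
    change ((x.out * 1 : W) : W ⧸ V) = x
    rw [mul_one, QuotientGroup.out_eq']
  simp only [h1, hmul, hφs, h2]

/-! ### Coxeter relations for twisted actions; double edges -/

theorem smul_simple_smul_simple (j : B) (x : X) : cs.simple j • cs.simple j • x = x := by
  rw [smul_smul, cs.simple_mul_simple_self, one_smul]

theorem simple_smul_ne_of_swap {l : B} {u v : X} (h1 : cs.simple l • u = v)
    (h2 : cs.simple l • v = u) (x : X) (hxu : x ≠ u) (hxv : x ≠ v) :
    cs.simple l • x ≠ u ∧ cs.simple l • x ≠ v :=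
  ⟨fun h => hxv (by rw [← cs.smul_simple_smul_simple l x, h, h1]),
    fun h => hxu (by rw [← cs.smul_simple_smul_simple l x, h, h2])⟩

theorem shear_mul_shear_pow_of_coboundary {G : Type*} [AddCommGroup G] (c : B → X → G) (i j : B)
    (h : X → G) (hi : ∀ x, c i x = h (cs.simple i • x) - h x)
    (hj : ∀ x, c j x = h (cs.simple j • x) - h x) :
    (cs.shear c i * cs.shear c j) ^ M i j = 1 := by
  have key : ∀ k : ℕ, ∀ x a, ((cs.shear c i * cs.shear c j) ^ k) (x, a) =
      ((cs.simple i * cs.simple j) ^ k • x,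
        a + h ((cs.simple i * cs.simple j) ^ k • x) - h x) := by
    intro k
    induction k with
    | zero => intro x a; rw [pow_zero, pow_zero, one_smul, add_sub_cancel_right]; rfl
    | succ k ih =>
      intro x a
      rw [pow_succ', pow_succ']
      change (cs.shear c i * cs.shear c j) (((cs.shear c i * cs.shear c j) ^ k) (x, a)) = _
      rw [ih, shear_mul_apply, hi, hj, mul_smul, mul_smul]
      congr 1
      abel
  funext ⟨x, a⟩
  rw [key, cs.simple_mul_simple_pow, one_smul, add_sub_cancel_right]
  rfl

/-- The cocycle lives on a double edge; each turn around it adds `α - β` up to sign, so only the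
total over `M i j` turns matters. -/
theorem shear_mul_shear_pow_of_swap {G : Type*} [AddCommGroup G] (c : B → X → G) (i j : B)
    {u v : X} (huv : u ≠ v) (hi : cs.simple i • u = v) (hj : cs.simple j • u = v) (α β : G)
    (hiu : c i u = α) (hiv : c i v = -α) (hi0 : ∀ x, x ≠ u → x ≠ v → c i x = 0)
    (hju : c j u = β) (hjv : c j v = -β) (hj0 : ∀ x, x ≠ u → x ≠ v → c j x = 0)
    (hm : M i j • (α - β) = 0) :
    (cs.shear c i * cs.shear c j) ^ M i j = 1 := by
  have hi' : cs.simple i • v = u := by rw [← hi, smul_simple_smul_simple]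
  have hj' : cs.simple j • v = u := by rw [← hj, smul_simple_smul_simple]
  have ku : ∀ k : ℕ, ∀ a, ((cs.shear c i * cs.shear c j) ^ k) (u, a) = (u, a - k • (α - β)) := by
    intro k
    induction k with
    | zero => intro a; rw [pow_zero, zero_nsmul, sub_zero]; rfl
    | succ k ih =>
      intro a
      rw [pow_succ']
      change (cs.shear c i * cs.shear c j) (((cs.shear c i * cs.shear c j) ^ k) (u, a)) = _
      rw [ih, shear_mul_apply, hj, hi', hju, hiv, succ_nsmul]
      congr 1
      abel
  have kv : ∀ k : ℕ, ∀ a, ((cs.shear c i * cs.shear c j) ^ k) (v, a) = (v, a + k • (α - β)) := by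
    intro k
    induction k with
    | zero => intro a; rw [pow_zero, zero_nsmul, add_zero]; rfl
    | succ k ih =>
      intro a
      rw [pow_succ']
      change (cs.shear c i * cs.shear c j) (((cs.shear c i * cs.shear c j) ^ k) (v, a)) = _
      rw [ih, shear_mul_apply, hj', hi, hjv, hiu, succ_nsmul]
      congr 1
      abel
  have kx : ∀ k : ℕ, ∀ x a, x ≠ u → x ≠ v → ((cs.shear c i * cs.shear c j) ^ k) (x, a) =
      ((cs.simple i * cs.simple j) ^ k • x, a) := by
    intro k
    induction k with
    | zero => intro x a _ _; rw [pow_zero, pow_zero, one_smul]; rfl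
    | succ k ih =>
      intro x a hxu hxv
      obtain ⟨h1, h2⟩ := cs.simple_smul_ne_of_swap hj hj' x hxu hxv
      obtain ⟨h3, h4⟩ := cs.simple_smul_ne_of_swap hi hi' _ h1 h2
      rw [pow_succ, pow_succ]
      change ((cs.shear c i * cs.shear c j) ^ k) ((cs.shear c i * cs.shear c j) (x, a)) = _
      rw [shear_mul_apply, hi0 _ h1 h2, hj0 _ hxu hxv, add_zero, add_zero, ih _ _ h3 h4,
        mul_smul, mul_smul]
  funext ⟨x, a⟩
  by_cases hxu : x = u
  · subst hxu; rw [ku, hm, sub_zero]; rfl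
  by_cases hxv : x = v
  · subst hxv; rw [kv, hm, add_zero]; rfl
  rw [kx _ _ _ hxu hxv, cs.simple_mul_simple_pow, one_smul]; rfl

/-- If all generators in `S` interchange `u` and `v`, then no generator outside `S` does, provided
that twisting the edges from `u` to `v` labelled by `S` gives a cocycle modulo `k`. -/
theorem not_swap_of_hasPotentials (hX : cs.HasPotentials X) {u v : X} (huv : u ≠ v) (S : Set B)
    (hS : ∀ i ∈ S, cs.simple i • u = v) {k : ℕ} (hk : 1 < k)
    (h : ∀ i ∈ S, ∀ j ∉ S, M i j = 0 ∨ cs.simple j • u = u ∨ cs.simple j • v = v ∨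
      (cs.simple j • u = v ∧ k ∣ M i j)) {p q : B} (hp : p ∈ S) (hq : q ∉ S) :
    cs.simple q • u ≠ v := by
  classical
  intro hqu
  have hS' : ∀ i ∈ S, cs.simple i • v = u := fun i hi => by
    rw [← hS i hi, cs.smul_simple_smul_simple]
  -- A potential for this `c` would have to increase by 1 from `u` to `v` along `p ∈ S`, but by 0
  -- along `q ∉ S`.
  let c : B → X → ZMod k := fun j x =>
    if j ∈ S then (if x = u then 1 else if x = v then -1 else 0) else 0
  have cu : ∀ i ∈ S, c i u = 1 := fun i hi => by simp [c, hi]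
  have cv : ∀ i ∈ S, c i v = -1 := fun i hi => by simp [c, hi, huv.symm]
  have cx : ∀ i x, x ≠ u → x ≠ v → c i x = 0 := fun i x h1 h2 => by simp [c, h1, h2]
  have cS : ∀ j ∉ S, ∀ x, c j x = 0 := fun j hj x => by simp [c, hj]
  -- When `s_j` fixes an end of the edge, the indicator of that end, with suitable sign, is a
  -- potential for the pair `i, j`.
  have hcob : ∀ i ∈ S, ∀ j ∉ S, (cs.simple j • u = u ∨ cs.simple j • v = v) →
      ∃ g : X → ZMod k, (∀ x, c i x = g (cs.simple i • x) - g x) ∧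
        (∀ x, c j x = g (cs.simple j • x) - g x) := by
    have hfix : ∀ j, ∀ y : X, cs.simple j • y = y → ∀ x, cs.simple j • x = y ↔ x = y := by
      intro j y hy x
      constructor
      · intro h; rw [← cs.smul_simple_smul_simple j x, h, hy]
      · rintro rfl; exact hy
    intro i hi j hj hor
    rcases hor with hju | hjv
    · refine ⟨fun x => if x = u then -1 else 0, fun x => ?_, fun x => ?_⟩
      · by_cases hxu : x = u
        · subst hxu; rw [cu i hi, hS i hi]; simp [huv.symm]
        by_cases hxv : x = v
        · subst hxv; rw [cv i hi, hS' i hi]; simp [huv.symm]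
        rw [cx i x hxu hxv]
        simp [hxu, (cs.simple_smul_ne_of_swap (hS i hi) (hS' i hi) x hxu hxv).1]
      · rw [cS j hj]
        simp [hfix j u hju]
    · refine ⟨fun x => if x = v then 1 else 0, fun x => ?_, fun x => ?_⟩
      · by_cases hxu : x = u
        · subst hxu; rw [cu i hi, hS i hi]; simp [huv]
        by_cases hxv : x = v
        · subst hxv; rw [cv i hi, hS' i hi]; simp [huv]
        rw [cx i x hxu hxv]
        simp [hxv, (cs.simple_smul_ne_of_swap (hS i hi) (hS' i hi) x hxu hxv).2]
      · rw [cS j hj]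
        simp [hfix j v hjv]
  have hrel : M.IsLiftable (cs.shear c) := by
    intro i j
    by_cases hi : i ∈ S <;> by_cases hj : j ∈ S
    · exact cs.shear_mul_shear_pow_of_swap c i j huv (hS i hi) (hS j hj) 1 1 (cu i hi) (cv i hi)
        (cx i) (cu j hj) (cv j hj) (cx j) (by simp)
    · have hor := h i hi j hj
      rcases hor with h0 | h1 | h1 | ⟨h1, h2⟩
      · rw [h0, pow_zero]
      · obtain ⟨g, g1, g2⟩ := hcob i hi j hj (Or.inl h1)
        exact cs.shear_mul_shear_pow_of_coboundary c i j g g1 g2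
      · obtain ⟨g, g1, g2⟩ := hcob i hi j hj (Or.inr h1)
        exact cs.shear_mul_shear_pow_of_coboundary c i j g g1 g2
      · refine cs.shear_mul_shear_pow_of_swap c i j huv (hS i hi) h1 1 0 (cu i hi) (cv i hi)
          (cx i) (cS j hj _) (by simp [cS j hj]) (cx j) ?_
        simpa using (ZMod.natCast_eq_zero_iff _ _).2 h2
    · have hor := h j hj i hi
      rw [M.symmetric j i] at hor
      rcases hor with h0 | h1 | h1 | ⟨h1, h2⟩
      · rw [h0, pow_zero]
      · obtain ⟨g, g1, g2⟩ := hcob j hj i hi (Or.inl h1)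
        exact cs.shear_mul_shear_pow_of_coboundary c i j g g2 g1
      · obtain ⟨g, g1, g2⟩ := hcob j hj i hi (Or.inr h1)
        exact cs.shear_mul_shear_pow_of_coboundary c i j g g2 g1
      · refine cs.shear_mul_shear_pow_of_swap c i j huv h1 (hS j hj) 0 1 (cS i hi _)
          (by simp [cS i hi]) (cx i) (cu j hj) (cv j hj) (cx j) ?_
        simpa using (ZMod.natCast_eq_zero_iff _ _).2 h2
    · exact cs.shear_mul_shear_pow_of_coboundary c i j 0 (by simp [cS i hi]) (by simp [cS j hj])
  have hfix : ∀ j x, cs.simple j • x = x → c j x = 0 := by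
    intro j x hjx
    by_cases hj : j ∈ S
    · refine cx j x ?_ ?_
      · rintro rfl; exact huv (hjx.symm.trans (hS j hj))
      · rintro rfl; exact huv ((hS' j hj).symm.trans hjx)
    · exact cS j hj x
  obtain ⟨g, hg⟩ := hX (ZMod k) c hfix hrel
  have h1 := hg p u
  have h2 := hg q u
  rw [hS p hp, cu p hp] at h1
  rw [hqu, cS q hq] at h2
  have : Fact (1 < k) := ⟨hk⟩
  exact one_ne_zero (α := ZMod k) (add_left_cancel (h1.symm.trans h2))

/-! ### Single moved pairs and odd exponents -/

/-- `s_j` has exactly one orbit of length two in `O`. -/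
def MovesOnePair (O : Set X) (j : B) : Prop :=
  ∃ u ∈ O, cs.simple j • u ≠ u ∧
    ∀ x ∈ O, cs.simple j • x ≠ x → x = u ∨ x = cs.simple j • u

theorem exists_conj_of_odd {i j : B} (hm : Odd (M i j)) :
    ∃ w ∈ Subgroup.closure {cs.simple i, cs.simple j},
      w * cs.simple i * w⁻¹ = cs.simple j := by
  obtain ⟨k, hk⟩ := hm
  have hsi : cs.simple i ∈ Subgroup.closure {cs.simple i, cs.simple j} :=
    Subgroup.subset_closure (by simp)
  have hsj : cs.simple j ∈ Subgroup.closure {cs.simple i, cs.simple j} :=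
    Subgroup.subset_closure (by simp)
  -- With `M i j = 2k + 1`, the conjugate is `(s_i s_j)^(2k) s_i`, and multiplying it by `s_j` gives
  -- `(s_i s_j)^(2k+1) = 1`.
  refine ⟨(cs.simple i * cs.simple j) ^ k, pow_mem (mul_mem hsi hsj) _, ?_⟩
  have hconj : ∀ l : ℕ, cs.simple i * ((cs.simple i * cs.simple j) ^ l)⁻¹ =
      (cs.simple i * cs.simple j) ^ l * cs.simple i := by
    intro l
    rw [← inv_pow, mul_inv_rev, cs.inv_simple, cs.inv_simple]
    exact (SemiconjBy.pow_right (show SemiconjBy (cs.simple i) (cs.simple j * cs.simple i)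
      (cs.simple i * cs.simple j) from (mul_assoc _ _ _).symm) l)
  rw [mul_assoc, hconj, ← mul_assoc, ← pow_add]
  have h1 : (cs.simple i * cs.simple j) ^ (k + k) * (cs.simple i * cs.simple j) = 1 := by
    rw [← pow_succ, ← two_mul, ← hk, cs.simple_mul_simple_pow]
  rw [← mul_assoc] at h1
  exact (eq_inv_of_mul_eq_one_left h1).trans (cs.inv_simple j)

end CoxeterSystem

/-! ### Leaves of finite bipartite graphs -/

theorem two_mul_card_le_card_of_surjective {E C : Type*} [Fintype E] [Fintype C] (γ : E → C)
    (hγ : Function.Surjective γ) (h : ∀ e, ∃ e', γ e' = γ e ∧ e' ≠ e) :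
    2 * Fintype.card C ≤ Fintype.card E := by
  classical
  refine Finset.mul_card_image_le_card_of_maps_to (f := γ) (fun _ _ => Finset.mem_univ _) 2
    fun a _ => ?_
  obtain ⟨e, rfl⟩ := hγ a
  obtain ⟨e', h1, h2⟩ := h e
  exact Finset.one_lt_card.2 ⟨e', by simp [h1], e, by simp, h2⟩

/-- If every edge function of a bipartite graph is a sum of vertex functions, then the graph has
a vertex of degree one. -/
theorem exists_fiber_subsingleton_of_forall_eq_add {E A B : Type*} [Finite E] [Nonempty E]
    (α : E → A) (β : E → B)
    (h : ∀ f : E → ℚ, ∃ (g : A → ℚ) (k : B → ℚ), ∀ e, f e = g (α e) + k (β e)) :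
    ∃ e, (∀ e', α e' = α e → e' = e) ∨ (∀ e', β e' = β e → e' = e) := by
  classical
  have := Fintype.ofFinite E
  -- If all degrees are at least 2, there are at most as many vertices as edges, so the surjection
  -- `L` from vertex to edge functions is injective; but `(1, -1)` lies in its kernel.
  by_contra! hcon
  let VA := Set.range α
  let VB := Set.range β
  have : Fintype VA := Fintype.ofFinite _
  have : Fintype VB := Fintype.ofFinite _
  have hA : 2 * Fintype.card VA ≤ Fintype.card E :=
    two_mul_card_le_card_of_surjective (Set.rangeFactorization α)
      Set.rangeFactorization_surjective fun e => by
      obtain ⟨e', h1, h2⟩ := (hcon e).1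
      exact ⟨e', Subtype.ext h1, h2⟩
  have hB : 2 * Fintype.card VB ≤ Fintype.card E :=
    two_mul_card_le_card_of_surjective (Set.rangeFactorization β)
      Set.rangeFactorization_surjective fun e => by
      obtain ⟨e', h1, h2⟩ := (hcon e).2
      exact ⟨e', Subtype.ext h1, h2⟩
  let L : ((VA → ℚ) × (VB → ℚ)) →ₗ[ℚ] (E → ℚ) :=
    { toFun := fun p e => p.1 (Set.rangeFactorization α e) + p.2 (Set.rangeFactorization β e)
      map_add' := fun p q => by funext e; simp only [Prod.fst_add, Prod.snd_add, Pi.add_apply]; ring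
      map_smul' := fun a p => by funext e; simp [mul_add] }
  have hsurj : Function.Surjective L := fun f => by
    obtain ⟨g, k, hgk⟩ := h f
    exact ⟨(fun a => g a, fun b => k b), funext fun e => (hgk e).symm⟩
  have hle : Module.finrank ℚ ((VA → ℚ) × (VB → ℚ)) ≤ Module.finrank ℚ (E → ℚ) := by
    simp only [Module.finrank_prod, Module.finrank_fintype_fun_eq_card]
    omega
  have hinj : Function.Injective L := by
    have hge := LinearMap.finrank_le_finrank_of_surjective hsurj
    exact (LinearMap.injective_iff_surjective_of_finrank_eq_finrank (le_antisymm hle hge)).2 hsurj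
  obtain ⟨e⟩ := ‹Nonempty E›
  have h0 : L (fun _ => 1, fun _ => -1) = L 0 := by
    funext e
    simp [L]
  have := congrFun (congrArg Prod.fst (hinj h0)) (Set.rangeFactorization α e)
  simp at this

/-! ### Orbits with a single moved pair -/

namespace CoxeterSystem

variable {B : Type*} {M : CoxeterMatrix B} {W : Type*} [Group W] (cs : CoxeterSystem M W)
  {X : Type*} [MulAction W X]

theorem smul_mem_of_mem_closure {O : Set X} {i j : B}
    (hi : ∀ x ∈ O, cs.simple i • x ∈ O) (hj : ∀ x ∈ O, cs.simple j • x ∈ O) {w : W}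
    (hw : w ∈ Subgroup.closure {cs.simple i, cs.simple j}) : ∀ x ∈ O, w • x ∈ O := by
  induction hw using Subgroup.closure_induction'' with
  | mem y hy => rcases hy with rfl | rfl <;> assumption
  | inv_mem y hy => rcases hy with rfl | rfl <;> rw [cs.inv_simple] <;> assumption
  | one => intro x hx; rwa [one_smul]
  | mul y z _ _ ihy ihz => intro x hx; rw [mul_smul]; exact ihy _ (ihz _ hx)

/-- The element conjugating `s_i` to `s_j` lies in the dihedral subgroup they generate, which
preserves `O`, so it carries one moved pair to the other. -/
theorem MovesOnePair.of_odd {O : Set X} {i j : B} (h : cs.MovesOnePair O i)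
    (hm : Odd (M i j)) (hi : ∀ x ∈ O, cs.simple i • x ∈ O) (hj : ∀ x ∈ O, cs.simple j • x ∈ O) :
    cs.MovesOnePair O j := by
  obtain ⟨w, hw, hwij⟩ := cs.exists_conj_of_odd hm
  obtain ⟨u, huO, hu, huniq⟩ := h
  have hsj : ∀ x : X, cs.simple j • w • x = w • cs.simple i • x := fun x => by
    rw [← hwij]
    simp only [mul_smul, inv_smul_smul]
  refine ⟨w • u, cs.smul_mem_of_mem_closure hi hj hw u huO, ?_, fun x hx hxj => ?_⟩
  · rw [hsj]
    exact fun h => hu (smul_left_cancel _ h)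
  · have h1 : cs.simple j • x = w • cs.simple i • w⁻¹ • x := by rw [← hsj, smul_inv_smul]
    have h2 := huniq (w⁻¹ • x) (cs.smul_mem_of_mem_closure hi hj (inv_mem hw) x hx) fun h => by
      rw [h, smul_inv_smul] at h1
      exact hxj h1
    rw [hsj]
    rcases h2 with h2 | h2
    · left; rw [← h2, smul_inv_smul]
    · right; rw [← h2, smul_inv_smul]

theorem simple_smul_eq_of_odd {i j : B} (hm : Odd (M i j))
    (h : ∀ x : X, cs.simple i • x = x) (x : X) : cs.simple j • x = x := by
  obtain ⟨w, -, hwij⟩ := cs.exists_conj_of_odd hm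
  rw [← hwij, mul_smul, mul_smul, h, smul_inv_smul]

theorem not_movesOnePair (hX : cs.HasPotentials X) {O : Set X} {p q r : B}
    (hpq : p ≠ q) (hrp : r ≠ p) (hrq : r ≠ q)
    (hOp : ∀ x ∈ O, cs.simple p • x ∈ O) (hOq : ∀ x ∈ O, cs.simple q • x ∈ O)
    (h0 : M p q ≠ 0) (h5 : 5 ≤ (M p q).minFac) (hqr : 3 ∣ M q r) (hpr : 3 ∣ M p r)
    (hpj : ∀ j, j ≠ p → j ≠ q → j ≠ r → M p j = 0 ∧ M q j = 0)
    (hp : cs.MovesOnePair O p) (hq : cs.MovesOnePair O q) (hr : cs.MovesOnePair O r) : False := by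
  obtain ⟨u, huO, hu, huq⟩ := hq
  obtain ⟨v, hv⟩ : ∃ v, v = cs.simple q • u := ⟨_, rfl⟩
  have hvO : v ∈ O := hv ▸ hOq u huO
  rw [← hv] at hu huq
  have hqv : cs.simple q • v = u := by rw [hv, cs.smul_simple_smul_simple]
  have hfixq : ∀ x ∈ O, x ≠ u → x ≠ v → cs.simple q • x = x := fun x hx h1 h2 => by
    by_contra h3
    rcases huq x hx h3 with h | h
    exacts [h1 h, h2 h]
  have hfixp : ∀ x ∈ O, ∀ y ∈ O, cs.simple p • x ≠ x → y ≠ x → y ≠ cs.simple p • x →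
      cs.simple p • y = y := fun x hx y hy h1 h2 h3 => by
    obtain ⟨a, -, -, ha⟩ := hp
    by_contra h4
    have h5 := cs.smul_simple_smul_simple p a
    have h6 := cs.smul_simple_smul_simple p x
    rcases ha x hx h1 with h | h <;> rcases ha y hy h4 with h' | h' <;> subst h <;> subst h' <;>
      simp_all
  have hpu : cs.simple p • u = v := by
    -- On `O` both generators are transpositions, so their product has order 1, 2 or 3 there. As `M
    -- p q` is prime to 6, the order is 1 at `u`, and the pairs coincide.
    have h6 : (cs.simple q * cs.simple p) ^ 6 • u = u := by
      have h23 : ((cs.simple q * cs.simple p) ^ 2 • u = u) ∨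
          ((cs.simple q * cs.simple p) ^ 3 • u = u) := by
        simp only [pow_succ, pow_zero, one_mul, mul_smul]
        by_cases hpu : cs.simple p • u = u
        · by_cases hpv : cs.simple p • v = v
          · left; rw [hpu, ← hv, hpv, hqv]
          · right
            have hz := hOp v hvO
            have hzu : cs.simple p • v ≠ u := fun h => hu (by
              rw [← cs.smul_simple_smul_simple p v, h, hpu])
            rw [hpu, ← hv, hfixq _ hz hzu hpv, cs.smul_simple_smul_simple, hqv]
        · have hz := hOp u huO
          by_cases hpv : cs.simple p • u = v
          · left; rw [hpv, hqv, hpv, hqv]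
          · right
            rw [hfixq _ hz hpu hpv, cs.smul_simple_smul_simple, ← hv,
              hfixp u huO v hvO hpu hu (Ne.symm hpv), hqv]
      rcases h23 with h | h
      · rw [show 6 = 2 * 3 from rfl, pow_mul, pow_three, mul_smul, mul_smul, h, h, h]
      · rw [show 6 = 3 * 2 from rfl, pow_mul, pow_two, mul_smul, h, h]
    have hm : (cs.simple q * cs.simple p) ^ M p q • u = u := by
      rw [cs.simple_mul_simple_pow', one_smul]
    have hcop : Nat.Coprime 6 (M p q) := by
      have h2 : ¬ 2 ∣ M p q := fun h => by
        have := Nat.minFac_le_of_dvd le_rfl h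
        omega
      have h3 : ¬ 3 ∣ M p q := fun h => by
        have := Nat.minFac_le_of_dvd (by norm_num) h
        omega
      exact Nat.Coprime.mul_left (m := 2) (n := 3)
        ((Nat.Prime.coprime_iff_not_dvd Nat.prime_two).2 h2)
        ((Nat.Prime.coprime_iff_not_dvd Nat.prime_three).2 h3)
    have hper : MulAction.period (cs.simple q * cs.simple p) u ∣ 1 := hcop ▸
      Nat.dvd_gcd (MulAction.pow_smul_eq_iff_period_dvd.1 h6)
        (MulAction.pow_smul_eq_iff_period_dvd.1 hm)
    have h1 : cs.simple q • cs.simple p • u = u := by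
      rw [← mul_smul, ← pow_one (cs.simple q * cs.simple p)]
      exact MulAction.pow_smul_eq_iff_period_dvd.2 hper
    rw [hv]
    conv_rhs => rw [← h1]
    rw [cs.smul_simple_smul_simple]
  have hqu := hv.symm
  -- If `s_r` also swaps `u` and `v`, twist `p` and `q` together modulo 3. Otherwise `s_r` fixes `u`
  -- or `v`, and `p` alone can be twisted modulo `M p q`.
  by_cases hru : cs.simple r • u = v
  · refine cs.not_swap_of_hasPotentials hX (Ne.symm hu) {p, q} ?_ (k := 3) (by norm_num) ?_
      (p := p) (q := r) (by simp) (by simp [hrp, hrq]) hru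
    · rintro i (rfl | rfl) <;> assumption
    · intro i hi j hj
      simp only [Set.mem_insert_iff, Set.mem_singleton_iff, not_or] at hi hj
      by_cases hjr : j = r
      · subst hjr
        right; right; right
        rcases hi with rfl | rfl
        exacts [⟨hru, hpr⟩, ⟨hru, hqr⟩]
      · left
        rcases hi with rfl | rfl
        exacts [(hpj j hj.1 hj.2 hjr).1, (hpj j hj.1 hj.2 hjr).2]
  · have hm1 : 1 < M p q := by
      have : M p q ≠ 1 := fun h => by rw [h] at h5; norm_num at h5
      omega
    refine cs.not_swap_of_hasPotentials hX (Ne.symm hu) {p} ?_ hm1 ?_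
      (p := p) (q := q) (by simp) (by simpa using hpq.symm) hqu
    · rintro i rfl; exact hpu
    · rintro i rfl j hj
      by_cases hjq : j = q
      · subst hjq; right; right; right; exact ⟨hqu, dvd_rfl⟩
      by_cases hjr : j = r
      · subst hjr
        right
        obtain ⟨a, -, -, ha⟩ := hr
        by_contra! hc
        rcases ha u huO hc.1 with h | h <;> rcases ha v hvO hc.2.1 with h' | h'
        · exact hu (h'.trans h.symm)
        · exact hru (by rw [h, h'])
        · exact hru (by rw [h, h', cs.smul_simple_smul_simple])
        · exact hu (h'.trans h.symm)
      · exact Or.inl (hpj j hj hjq hjr).1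

/-- If the Coxeter group is the amalgamated product of two standard parabolic subgroups over the
subgroup generated by `s_h`, then each `s_h`-invariant function is a sum of two functions invariant
under one of the factors each. -/
theorem exists_add_of_hasPotentials (hX : cs.HasPotentials X) {A A' : Set B} {h : B}
    (hunion : ∀ j, j ∈ A ∨ j ∈ A') (hinter : ∀ j ∈ A, j ∈ A' → j = h)
    (hM : ∀ i ∉ A', ∀ j ∉ A, M i j = 0) (f : X → ℚ) (hf : ∀ x, f (cs.simple h • x) = f x) :
    ∃ g k : X → ℚ, (∀ j ∈ A, ∀ x, g (cs.simple j • x) = g x) ∧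
      (∀ j ∈ A', ∀ x, k (cs.simple j • x) = k x) ∧ ∀ x, f x = g x + k x := by
  classical
  -- Zero on `A` and the coboundary of `f` on `A'`; these agree at `h` since `f` is `s_h`-invariant,
  -- and no finite relation mixes the two sides.
  let c : B → X → ℚ := fun j x => if j ∈ A then 0 else f (cs.simple j • x) - f x
  have cA : ∀ j ∈ A, ∀ x, c j x = 0 := fun j hj x => by simp [c, hj]
  have cA' : ∀ j ∈ A', ∀ x, c j x = f (cs.simple j • x) - f x := fun j hj x => by
    by_cases hjA : j ∈ A
    · rw [cA j hjA, hinter j hjA hj, hf, sub_self]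
    · simp [c, hjA]
  have hrel : M.IsLiftable (cs.shear c) := by
    intro i j
    by_cases h1 : i ∈ A ∧ j ∈ A
    · exact cs.shear_mul_shear_pow_of_coboundary c i j 0 (by simp [cA i h1.1])
        (by simp [cA j h1.2])
    by_cases h2 : i ∈ A' ∧ j ∈ A'
    · exact cs.shear_mul_shear_pow_of_coboundary c i j f (cA' i h2.1) (cA' j h2.2)
    have h0 : M i j = 0 := by
      by_cases hi : i ∈ A'
      · have hj : j ∉ A' := fun hj => h2 ⟨hi, hj⟩
        rw [M.symmetric]
        exact hM j hj i fun hi' => h1 ⟨hi', (hunion j).resolve_right hj⟩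
      · exact hM i hi j fun hj => h1 ⟨(hunion i).resolve_right hi, hj⟩
    rw [h0, pow_zero]
  obtain ⟨g, hg⟩ := hX ℚ c (fun j x hjx => by simp only [c, hjx, sub_self, ite_self]) hrel
  refine ⟨g, fun x => f x - g x, fun j hj x => by rw [hg, cA j hj, add_zero], fun j hj x => ?_,
    fun x => by ring⟩
  simp only [hg, cA' j hj]
  ring

theorem exists_movesOnePair [Finite X] (hX : cs.HasPotentials X) {A A' : Set B} {h : B}
    (hhA : h ∈ A) (hhA' : h ∈ A') (hunion : ∀ j, j ∈ A ∨ j ∈ A')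
    (hinter : ∀ j ∈ A, j ∈ A' → j = h) (hM : ∀ i ∉ A', ∀ j ∉ A, M i j = 0)
    (hmove : ∃ x : X, cs.simple h • x ≠ x) :
    ∃ O : Set X, cs.MovesOnePair O h ∧
      ((∀ j ∈ A, ∀ x ∈ O, cs.simple j • x ∈ O) ∨ (∀ j ∈ A', ∀ x ∈ O, cs.simple j • x ∈ O)) := by
  classical
  let P := {x : X // cs.simple h • x ≠ x}
  have : Nonempty P := let ⟨x, hx⟩ := hmove; ⟨⟨x, hx⟩⟩
  let S : Setoid P :=
    { r := fun x y => y.1 = x.1 ∨ y.1 = cs.simple h • x.1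
      iseqv :=
        { refl := fun x => Or.inl rfl
          symm := fun {x y} hxy => hxy.imp Eq.symm fun e => by
            rw [e, cs.smul_simple_smul_simple]
          trans := fun {x y z} hxy hyz => by
            rcases hxy with e | e <;> rcases hyz with e' | e' <;>
              simp [e, e', cs.smul_simple_smul_simple] } }
  let orb : Set B → X → X → Prop := fun C x y => ∃ j ∈ C, y = cs.simple j • x
  have horb : ∀ {C : Set B} {j}, j ∈ C → ∀ x,
      Quot.mk (orb C) (cs.simple j • x) = Quot.mk (orb C) x :=
    fun hj x => (Quot.sound ⟨_, hj, rfl⟩).symm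
  let pr : ∀ C : Set B, h ∈ C → Quotient S → Quot (orb C) := fun C hC =>
    Quotient.lift (fun x : P => Quot.mk (orb C) x.1) fun x y hxy => by
      rcases hxy with e | e
      · simp only [e]
      · simp only [e, horb hC]
  have : Nonempty (Quotient S) := this.map (Quotient.mk S)
  have key := exists_fiber_subsingleton_of_forall_eq_add (pr A hhA) (pr A' hhA') fun f => by
    -- Extension by zero to the fixed points of `s_h`.
    let F : X → ℚ := fun x => if hx : cs.simple h • x ≠ x then f (Quotient.mk S ⟨x, hx⟩) else 0
    have hF : ∀ x, F (cs.simple h • x) = F x := by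
      intro x
      by_cases hx : cs.simple h • x = x
      · rw [hx]
      · have hx' : cs.simple h • cs.simple h • x ≠ cs.simple h • x := by
          rw [cs.smul_simple_smul_simple]; exact Ne.symm hx
        have e1 : F x = f (Quotient.mk S ⟨x, hx⟩) := dif_pos hx
        have e2 : F (cs.simple h • x) = f (Quotient.mk S ⟨_, hx'⟩) := dif_pos hx'
        rw [e1, e2]
        exact congrArg f (Quotient.sound (Or.inr (cs.smul_simple_smul_simple h x).symm))
    obtain ⟨g, k, hg, hk, hgk⟩ :=
      cs.exists_add_of_hasPotentials hX hunion hinter hM F hF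
    refine ⟨Quot.lift g ?_, Quot.lift k ?_, ?_⟩
    · rintro x _ ⟨j, hj, rfl⟩; exact (hg j hj x).symm
    · rintro x _ ⟨j, hj, rfl⟩; exact (hk j hj x).symm
    · intro e
      induction e using Quotient.inductionOn with
      | h x =>
        have : F x.1 = f (Quotient.mk S x) := dif_pos x.2
        rw [← this]
        exact hgk x.1
  have fin : ∀ C (hC : h ∈ C) (e : Quotient S), (∀ e', pr C hC e' = pr C hC e → e' = e) →
      ∃ O : Set X, cs.MovesOnePair O h ∧ ∀ j ∈ C, ∀ x ∈ O, cs.simple j • x ∈ O := by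
    intro C hC e
    induction e using Quotient.inductionOn with
    | h u =>
      intro huniq
      -- `O` is the orbit of the leaf vertex.
      refine ⟨{x | Quot.mk (orb C) x = Quot.mk (orb C) u.1}, ⟨u.1, rfl, u.2, ?_⟩, ?_⟩
      · intro x hx hxh
        have h1 := huniq (Quotient.mk S ⟨x, hxh⟩) hx
        exact Quotient.exact h1.symm
      · intro j hj x hx
        exact (horb hj x).trans hx
  obtain ⟨e, he | he⟩ := key
  · obtain ⟨O, h1, h2⟩ := fin A hhA e he
    exact ⟨O, h1, Or.inl h2⟩
  · obtain ⟨O, h1, h2⟩ := fin A' hhA' e he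
    exact ⟨O, h1, Or.inr h2⟩

end CoxeterSystem

/-! ### Arithmetic of the diagram and conclusion -/

theorem odd_of_three_le_minFac {m : ℕ} (h : 3 ≤ m.minFac) : Odd m := by
  rw [← Nat.not_even_iff_odd, even_iff_two_dvd]
  intro h2
  have := Nat.minFac_le_of_dvd le_rfl h2
  omega

namespace CoxeterMatrix.IsPathSeries

variable {n : ℕ} {M : CoxeterMatrix (Fin n)}

theorem odd_of_succ (hM : M.IsPathSeries) {i j : Fin n} (hij : (j : ℕ) = (i : ℕ) + 1) :
    Odd (M i j) := by
  apply odd_of_three_le_minFac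
  by_cases hi : (i : ℕ) = 0
  · exact le_trans (by norm_num) (hM.first_edge i j hi (by omega)).2
  by_cases hj : (j : ℕ) + 1 = n
  · exact le_trans (by norm_num) (hM.last_edge i j (by omega) hj).2
  · exact (hM.inner_edge i j (by omega) hij (by omega)).2.ge

theorem eq_zero_of_lt (hM : M.IsPathSeries) {i j : Fin n} (hij : (i : ℕ) + 1 < (j : ℕ))
    (hl : ¬ ((i : ℕ) = 0 ∧ (j : ℕ) = 2)) (hr : ¬ ((i : ℕ) + 3 = n ∧ (j : ℕ) + 1 = n)) :
    M i j = 0 := by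
  by_contra h
  exact hM.no_other_edge i j hij hl hr ⟨fun e => by rw [e] at hij; omega, h⟩

theorem three_dvd_inner (hM : M.IsPathSeries) {i j : Fin n} (hi : 1 ≤ (i : ℕ))
    (hij : (j : ℕ) = (i : ℕ) + 1) (hj : (j : ℕ) + 2 ≤ n) : 3 ∣ M i j :=
  (hM.inner_edge i j hi hij hj).2 ▸ Nat.minFac_dvd _

theorem three_dvd_left (hM : M.IsPathSeries) {i j : Fin n} (hi : (i : ℕ) = 0)
    (hj : (j : ℕ) = 2) : 3 ∣ M i j := by
  by_cases h : M i j = 0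
  -- The exponent `∞` is encoded as 0, so divisibility by 3 also covers a missing chord.
  · rw [h]; exact dvd_zero 3
  · exact hM.left_chord i j hi hj ⟨fun e => by rw [e] at hi; omega, h⟩ ▸ Nat.minFac_dvd _

theorem three_dvd_right (hM : M.IsPathSeries) {i j : Fin n} (hi : (i : ℕ) + 3 = n)
    (hj : (j : ℕ) + 1 = n) : 3 ∣ M i j := by
  by_cases h : M i j = 0
  · rw [h]; exact dvd_zero 3
  · exact hM.right_chord i j hi hj ⟨fun e => by rw [e] at hi; omega, h⟩ ▸ Nat.minFac_dvd _

end CoxeterMatrix.IsPathSeries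

theorem lemma5p18 {n : ℕ} (hn : 5 ≤ n) (M : CoxeterMatrix (Fin n)) (hM : M.IsPathSeries)
    {W : Type*} [Group W] (cs : CoxeterSystem M W) :
    ¬ ∃ V : Subgroup W, cs.IsReflectionSubgroup V ∧ V.FiniteIndex := by
  rintro ⟨V, ⟨hV, T, hT, hTV⟩, hfin⟩
  have hX : cs.HasPotentials (W ⧸ V) := cs.hasPotentials_quotient hT hTV
  -- All generators are conjugate along the odd path, so if one acted trivially, all would, forcing
  -- `V = ⊤`.
  have hmove : ∃ x : W ⧸ V, cs.simple ⟨2, by omega⟩ • x ≠ x := by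
    by_contra! h
    have hiff : ∀ k (hk : k < n), (∀ x : W ⧸ V, cs.simple ⟨k, hk⟩ • x = x) ↔
        ∀ x : W ⧸ V, cs.simple ⟨0, by omega⟩ • x = x := by
      intro k
      induction k with
      | zero => intro hk; rfl
      | succ k ih =>
        intro hk
        rw [← ih (by omega)]
        have hodd : Odd (M ⟨k, by omega⟩ ⟨k + 1, hk⟩) := hM.odd_of_succ rfl
        exact ⟨fun h => cs.simple_smul_eq_of_odd (by rwa [M.symmetric]) h,
          fun h => cs.simple_smul_eq_of_odd hodd h⟩
    apply hV
    rw [eq_top_iff, ← cs.subgroup_closure_range_simple, Subgroup.closure_le]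
    rintro _ ⟨j, rfl⟩
    have h1 := (hiff j j.2).2 ((hiff 2 (by omega)).1 h) ((1 : W) : W ⧸ V)
    have h2 : ((1 : W) : W ⧸ V) = ((cs.simple j * 1 : W) : W ⧸ V) := h1.symm
    simpa using QuotientGroup.eq.1 h2
  obtain ⟨O, hO, hA | hB⟩ := cs.exists_movesOnePair hX
    (A := {j | (j : ℕ) ≤ 2}) (A' := {j | 2 ≤ (j : ℕ)}) (h := ⟨2, by omega⟩)
    (le_refl 2) (le_refl 2) (fun j => le_total (j : ℕ) 2)
    (fun j h1 h2 => Fin.ext (le_antisymm h1 h2))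
    (fun i hi j hj => by
      simp only [Set.mem_ofPred_eq, not_le] at hi hj
      -- Here `n ≥ 5` matters: the right chord starts at index `n - 3 ≥ 2`, so it does not cross the
      -- splitting vertex.
      exact hM.eq_zero_of_lt (by omega) (by omega) (by omega))
    hmove
  · have h1 : cs.MovesOnePair O ⟨1, by omega⟩ :=
      hO.of_odd cs (by rw [M.symmetric]; exact hM.odd_of_succ rfl) (hA _ (le_refl 2))
        (hA _ (by simp))
    have h0 : cs.MovesOnePair O ⟨0, by omega⟩ :=
      h1.of_odd cs (by rw [M.symmetric]; exact hM.odd_of_succ rfl) (hA _ (by simp))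
        (hA _ (by simp))
    have hfirst := hM.first_edge ⟨0, by omega⟩ ⟨1, by omega⟩ rfl rfl
    refine cs.not_movesOnePair hX (p := ⟨0, by omega⟩) (q := ⟨1, by omega⟩) (r := ⟨2, by omega⟩)
      (by simp) (by simp) (by simp) (hA _ (by simp)) (hA _ (by simp))
      hfirst.1.2 hfirst.2 (hM.three_dvd_inner (le_refl 1) rfl (by simp; omega))
      (hM.three_dvd_left rfl rfl) (fun j h0 h1 h2 => ?_) h0 h1 hO
    rw [Ne, Fin.ext_iff] at h0 h1 h2
    simp only at h0 h1 h2
    exact ⟨hM.eq_zero_of_lt (by simp; omega) (by omega) (by simp; omega),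
      hM.eq_zero_of_lt (by simp; omega) (by simp) (by simp; omega)⟩
  · have hk : ∀ k, 2 ≤ k → ∀ hk : k < n, cs.MovesOnePair O ⟨k, hk⟩ := by
      intro k hk2
      induction k, hk2 using Nat.le_induction with
      | base => intro _; exact hO
      | succ k hk2 ih =>
        intro hk
        exact (ih (by omega)).of_odd cs (hM.odd_of_succ rfl) (hB _ hk2)
          (hB _ (show 2 ≤ k + 1 by omega))
    have hlast := hM.last_edge ⟨n - 2, by omega⟩ ⟨n - 1, by omega⟩ (by simp; omega)
      (by simp; omega)
    refine cs.not_movesOnePair hX (p := ⟨n - 1, by omega⟩) (q := ⟨n - 2, by omega⟩)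
      (r := ⟨n - 3, by omega⟩) (by simp; omega) (by simp; omega) (by simp; omega)
      (hB _ (show 2 ≤ n - 1 by omega)) (hB _ (show 2 ≤ n - 2 by omega))
      (by rw [M.symmetric]; exact hlast.1.2) (by rw [M.symmetric]; exact hlast.2)
      (by
        rw [M.symmetric]
        exact hM.three_dvd_inner (by simp; omega) (by simp; omega) (by simp; omega))
      (by
        rw [M.symmetric]
        exact hM.three_dvd_right (by simp; omega) (by simp; omega))
      (fun j h0 h1 h2 => ?_) (hk _ (by omega) _) (hk _ (by omega) _) (hk _ (by omega) _)
    rw [Ne, Fin.ext_iff] at h0 h1 h2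
    simp only at h0 h1 h2
    rw [M.symmetric _ j, M.symmetric _ j]
    exact ⟨hM.eq_zero_of_lt (by simp; omega) (by simp; omega) (by simp; omega),
      hM.eq_zero_of_lt (by simp; omega) (by simp; omega) (by simp; omega)⟩
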